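/- **Setting.** Fix a finite relational signature; embeddings are injective maps that preserve and reflect all relations. Let $\mathcal K$ be a class of finite structures with a Fraïssé limit $\mathfrak U$, i.e. $\mathfrak U$ is a countable structure such that $\mathcal K$ is exactly the class of structures isomorphic to finite substructures of $\mathfrak U$, and every isomorphism between finite substructures of $\mathfrak U$ extends to an automorphism of $\mathfrak U$. Let $\mathbb D$ be the carrier of $\mathfrak U$ and $G=\mathrm{Aut}(\mathfrak U)$. Products of maps are composed from left to right, and groups act on the right. A set $C\subseteq\mathbb D$ *supports* an element $x$ of a $G$-set if $x\cdot\pi=x$ for every $\pi\in G$ that fixes each element of $C$. A $G$-set is *nominal* if each of its elements has a finite support, and *single-orbit* if it has exactly one orbit. Let $G\text{-}\mathbf{Nom}^1$ be the category of single-orbit nominal $G$-sets and equivariant functions. Assume that $(\mathbb D,G)$ is *well-behaved*, that is: * every element of every nominal $G$-set has a least finite support with respect to inclusion; * every finite $C\subseteq\mathbb D$ is fungible: for each $c\in C$ there is $\pi\in G$ with $\pi(c)\ne c$ and $\pi(c')=c'$ for all $c'\in C\setminus\{c\}$. For $\mathfrak A\in\mathcal K$, $S\le\mathrm{Aut}(\mathfrak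 A)$ and embeddings $u,v$ from $\mathfrak A$ into a structure, write $u\equiv_S v$ if $v=\tau u$ for some $\tau\in S$. Let $[\mathfrak A,S]$ be the set of embeddings $\mathfrak A\to\mathfrak U$ modulo $\equiv_S$, with the $G$-action $[u]\cdot\pi=[u\pi]$. Let $\mathcal R$ be the category whose objects are the pairs $(\mathfrak A,S)$ with $\mathfrak A\in\mathcal K$ and $S\le\mathrm{Aut}(\mathfrak A)$, and whose morphisms $(\mathfrak A,S)\to(\mathfrak B,T)$ are the embeddings $u:\mathfrak B\to\mathfrak A$ with $uS\subseteq Tu$, taken modulo $\equiv_T$; identities and composition are induced by those of embeddings. **Theorem.** 1. Every $[\mathfrak A,S]$ is a single-orbit nominal $G$-set. 2. Every single-orbit nominal $G$-set is isomorphic to some $[\mathfrak A,S]$. 3. For all $(\mathfrak A,S),(\mathfrak B,T)\in\mathcal R$, the map sending the class of $u:\mathfrak B\to\mathfrak A$ to the function $[v]\mapsto[uv]$ is a bijection from the morphisms $(\mathfrak A,S)\to(\mathfrak B,T)$ of $\mathcal R$ to the equivariant functions $[\mathfrak A,S]\to[\mathfrak B,T]$. 4. The categories $G\text{-}\mathbf{Nom}^1$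 and $\mathcal R$ are equivalent, by an equivalence whose functor $\mathcal R\to G\text{-}\mathbf{Nom}^1$ is naturally isomorphic to $(\mathfrak A,S)\mapsto[\mathfrak A,S]$, $[u]\mapsto([v]\mapsto[uv])$. -/

import Mathlib

open CategoryTheory
open scoped FirstOrder

universe u v w

namespace NominalRep

section DataSymmetries

/-! A data symmetry is a set `D` together with a subgroup `G` of `Equiv.Perm D`, acting on `D` by
application.  `Equiv.Perm` composes from right to left, so a right action of the group of
permutations composed from left to right is a left action (`MulAction`) of `G`. -/

variable {D : Type w} (G : Subgroup (Equiv.Perm D))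

/-- A `G`-set is nominal if every element has a finite support: a finite `C ⊆ D` such that every
`π ∈ G` that fixes each element of `C` also fixes `x`. -/
def IsNominal (X : Type w) [MulAction G X] : Prop :=
  ∀ x : X, ∃ C : Finset D, MulAction.Supports G (C : Set D) x

/-- Every element of every nominal `G`-set has a least finite support with respect to inclusion. -/
def AdmitsLeastSupports : Prop :=
  ∀ (X : Type w) [MulAction G X], IsNominal G X →
    ∀ x : X, ∃ C : Finset D, IsLeast {C : Finset D | MulAction.Supports G (C : Set D) x} C

/-- A finite set `C` is fungible if each `c ∈ C` can be moved by an element of `G` that fixes all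
the other elements of `C`. -/
def IsFungible (C : Finset D) : Prop :=
  ∀ c ∈ C, ∃ π ∈ G, π c ≠ c ∧ ∀ c' ∈ C, c' ≠ c → π c' = c'

/-- A data symmetry is fungible if all finite sets of data are. -/
def FungibleSymmetry : Prop :=
  ∀ C : Finset D, IsFungible G C

/-- A symmetry is well-behaved if it admits least supports and is fungible. -/
structure WellBehaved : Prop where
  admitsLeastSupports : AdmitsLeastSupports G
  fungible : FungibleSymmetry G

end DataSymmetries

section GSets

/-- A bundled `G`-set. -/
structure GSet (G : Type w) [Group G] : Type (w + 1) where
  carrier : Type w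
  [mulAction : MulAction G carrier]

attribute [instance] GSet.mulAction

/-- The category of `G`-sets and equivariant functions. -/
instance GSet.category (G : Type w) [Group G] : Category.{w} (GSet.{w} G) where
  Hom X Y := X.carrier →[G] Y.carrier
  id X := MulActionHom.id G
  comp f g := MulActionHom.comp g f

variable {D : Type w} (G : Subgroup (Equiv.Perm D))

/-- The property of being a single-orbit nominal `G`-set. -/
def IsSingleOrbitNominal : ObjectProperty (GSet G) := fun X =>
  Nonempty X.carrier ∧ MulAction.IsPretransitive G X.carrier ∧ IsNominal G X.carrier

/-- The category of single-orbit nominal `G`-sets and equivariant functions. -/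
abbrev SingleOrbitNom : Type (w + 1) := (IsSingleOrbitNominal G).FullSubcategory

end GSets

variable {L : FirstOrder.Language.{u, v}}

/-- The automorphism group of a structure, as a subgroup of the symmetric group on its carrier. -/
def autGroup (L : FirstOrder.Language.{u, v}) (M : Type w) [L.Structure M] : Subgroup (Equiv.Perm M) where
  carrier := {π | ∃ e : M ≃[L] M, e.toEquiv = π}
  mul_mem' := by
    rintro _ _ ⟨e, rfl⟩ ⟨f, rfl⟩
    exact ⟨e.comp f, rfl⟩
  one_mem' := ⟨FirstOrder.Language.Equiv.refl L M, rfl⟩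
  inv_mem' := by
    rintro _ ⟨e, rfl⟩
    exact ⟨e.symm, rfl⟩

/-- The relation `u ≡_S v` on embeddings `A → M`, for a group `S` of automorphisms of `A`: some
`τ ∈ S` satisfies `v = u ∘ τ`. -/
def embSetoid {A M : Type w} [L.Structure A] [L.Structure M] (S : Subgroup (autGroup L A)) :
    Setoid (A ↪[L] M) where
  r u v := ∃ τ ∈ S, ∀ a, u (τ.1 a) = v a
  iseqv := by
    refine ⟨fun u => ⟨1, S.one_mem, fun a => rfl⟩, ?_, ?_⟩
    · rintro u v ⟨τ, hτ, h⟩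
      refine ⟨τ⁻¹, S.inv_mem hτ, fun a => ?_⟩
      rw [← h]
      simp
    · rintro u v x ⟨τ, hτ, h⟩ ⟨ρ, hρ, h'⟩
      refine ⟨τ * ρ, S.mul_mem hτ hρ, fun a => ?_⟩
      rw [← h', ← h]
      simp

variable (K : Set (Bundled.{w} L.Structure))

/-- A structure representation over `K`: a structure `𝔄 ∈ K` together with `S ≤ Aut(𝔄)`. -/
structure StructRep where
  shape : Bundled.{w} L.Structure
  mem : shape ∈ K
  sym : Subgroup (autGroup L shape)

namespace StructRep

variable {K}

/-- Embeddings `u : 𝔅 → 𝔄` such that `uS ⊆ Tu` (composition written from left to right), i.e. for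
every `σ ∈ S` there is `τ ∈ T` with `σ ∘ u = u ∘ τ`. -/
def PreHom (X Y : StructRep K) :=
  {u : Y.shape ↪[L] X.shape // ∀ σ ∈ X.sym, ∃ τ ∈ Y.sym, ∀ b, σ.1 (u b) = u (τ.1 b)}

/-- The relation `≡_T` on the embeddings above. -/
def homSetoid (X Y : StructRep K) : Setoid (PreHom X Y) :=
  (embSetoid (M := X.shape) Y.sym).comap Subtype.val

/-- Morphisms `(𝔄, S) → (𝔅, T)`: classes modulo `≡_T` of embeddings `u : 𝔅 → 𝔄` with
`uS ⊆ Tu`. -/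
def Hom (X Y : StructRep K) := Quotient (homSetoid X Y)

/-- The identity embedding. -/
def PreHom.id (X : StructRep K) : PreHom X X :=
  ⟨FirstOrder.Language.Embedding.refl L X.shape, fun σ hσ => ⟨σ, hσ, fun _ => rfl⟩⟩

/-- Composition of embeddings `ℭ → 𝔅 → 𝔄`. -/
def PreHom.comp {X Y Z : StructRep K} (f : PreHom X Y) (g : PreHom Y Z) : PreHom X Z :=
  ⟨f.1.comp g.1, fun σ hσ => by
    obtain ⟨τ, hτ, h⟩ := f.2 σ hσ
    obtain ⟨ρ, hρ, h'⟩ := g.2 τ hτ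
    exact ⟨ρ, hρ, fun b => by simp [h, h']⟩⟩

/-- Composition of classes of embeddings. -/
def Hom.comp {X Y Z : StructRep K} (f : Hom X Y) (g : Hom Y Z) : Hom X Z :=
  Quotient.map₂ (sa := homSetoid X Y) (sb := homSetoid Y Z) (sc := homSetoid X Z) PreHom.comp
    (by
      rintro f f' ⟨τ, hτ, h⟩ g g' ⟨ρ, hρ, h'⟩
      obtain ⟨ρ', hρ', h''⟩ := g.2 τ hτ
      refine ⟨ρ' * ρ, Z.sym.mul_mem hρ' hρ, fun b => ?_⟩
      change f.1 (g.1 (ρ'.1 (ρ.1 b))) = f'.1 (g'.1 b)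
      rw [← h'', h, h']) f g

/-- The category of structure representations. -/
instance : Category (StructRep K) where
  Hom := Hom
  id X := Quotient.mk (homSetoid X X) (PreHom.id X)
  comp := Hom.comp
  id_comp := by
    rintro X Y ⟨f⟩
    rfl
  comp_id := by
    rintro X Y ⟨f⟩
    rfl
  assoc := by
    rintro X Y Z W ⟨f⟩ ⟨g⟩ ⟨h⟩
    rfl

variable (U : Type w) [L.Structure U]

/-- The set of embeddings `𝔄 → U` modulo `≡_S`. -/
def Sem (X : StructRep K) : Type w := Quotient (embSetoid (M := U) X.sym)

/-- An automorphism of `U`, as an embedding of `U` into itself. -/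
noncomputable def autEmb (π : autGroup L U) : U ↪[L] U := π.2.choose.toEmbedding

theorem autEmb_apply (π : autGroup L U) (x : U) : autEmb U π x = π.1 x :=
  DFunLike.congr_fun π.2.choose_spec x

/-- The automorphisms of `U` act by composition, `π • [u] = [π ∘ u]`. -/
noncomputable instance (X : StructRep K) : MulAction (autGroup L U) (Sem U X) where
  smul π := Quotient.map (sa := embSetoid (M := U) X.sym) (sb := embSetoid (M := U) X.sym)
    (fun u => (autEmb U π).comp u) (by
      rintro u v ⟨τ, hτ, h⟩
      exact ⟨τ, hτ, fun a => by simp [h]⟩)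
  one_smul := by
    rintro ⟨u⟩
    refine Quotient.sound ⟨1, X.sym.one_mem, fun a => ?_⟩
    simp [autEmb_apply]
  mul_smul := by
    rintro π σ ⟨u⟩
    refine Quotient.sound ⟨1, X.sym.one_mem, fun a => ?_⟩
    simp [autEmb_apply]

/-- The equivariant function `[v] ↦ [v ∘ u]` induced by a morphism `[u]`. -/
def Sem.map {X Y : StructRep K} (f : Hom X Y) : Sem U X →[autGroup L U] Sem U Y where
  toFun := Quotient.map₂ (sa := homSetoid X Y) (sb := embSetoid (M := U) X.sym)
    (sc := embSetoid (M := U) Y.sym) (fun u v => v.comp u.1) (by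
      rintro u u' ⟨τ, hτ, h⟩ v v' ⟨σ, hσ, h'⟩
      obtain ⟨τ', hτ', h''⟩ := u.2 σ hσ
      refine ⟨τ' * τ, Y.sym.mul_mem hτ' hτ, fun b => ?_⟩
      change v (u.1 (τ'.1 (τ.1 b))) = v' (u'.1 b)
      rw [← h'', h, h']) f
  map_smul' := by
    rintro π ⟨v⟩
    obtain ⟨u⟩ := f
    rfl

/-- The semantics of structure representations, as a functor to `G`-sets for `G = Aut(U)`. -/
noncomputable def sem : StructRep K ⥤ GSet (autGroup L U) where
  obj X := ⟨Sem U X⟩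
  map f := Sem.map U f
  map_id := by
    rintro X
    refine MulActionHom.ext ?_
    rintro ⟨v⟩
    rfl
  map_comp := by
    rintro X Y Z ⟨f⟩ ⟨g⟩
    refine MulActionHom.ext ?_
    rintro ⟨v⟩
    rfl

end StructRep

end NominalRep

/-! A transitive `G`-set is determined by the stabilizer of one point, and equivariant functions out
of it correspond to points with a larger stabilizer. Homogeneity puts all embeddings of a finite
structure in one orbit, so each `[𝔄, S]` is transitive; the range of `v` supports `[v]`. An
equivariant function sends `[v]` to some `[w]` supported by the range of `v`. Fungibility puts the
range of `w` inside that range (`Sem.mem_of_supports`), so `w` factors through `v` by the required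
embedding. Conversely, the least support of a point `x` is preserved by the stabilizer of `x`. That
finite substructure, with the restrictions of the stabilizer as its group, represents the orbit of
`x`. -/

open FirstOrder.Language in
/-- In an ultrahomogeneous structure, automorphisms act transitively on the embeddings of a
finitely generated structure. -/
theorem FirstOrder.Language.IsUltrahomogeneous.exists_autGroup {L : FirstOrder.Language.{u, v}}
    {U : Type w} [L.Structure U] (hU : L.IsUltrahomogeneous U) {A : Type w} [L.Structure A]
    (hA : Structure.FG L A) (f g : A ↪[L] U) :
    ∃ π : NominalRep.autGroup L U, ∀ a, π.1 (f a) = g a := by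
  obtain ⟨e, he⟩ := hU f.toHom.range (hA.range f.toHom)
    (g.comp f.equivRange.symm.toEmbedding)
  refine ⟨⟨e.toEquiv, e, rfl⟩, fun a => ?_⟩
  have h := DFunLike.congr_fun he (f.equivRange a)
  simp only [FirstOrder.Language.Embedding.comp_apply,
    FirstOrder.Language.Equiv.coe_toEmbedding, FirstOrder.Language.Equiv.symm_apply_apply] at h
  exact h.symm

/-- A point of a transitive `G`-set is sent by some equivariant function to any point with a
larger stabilizer. -/
theorem MulAction.IsPretransitive.exists_hom {G X Y : Type*} [Group G] [MulAction G X]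
    [MulAction G Y] [MulAction.IsPretransitive G X] (x : X) (y : Y)
    (h : ∀ g : G, g • x = x → g • y = y) : ∃ f : X →[G] Y, f x = y := by
  choose t ht using fun z : X => MulAction.exists_smul_eq G x z
  -- This makes the value `t z • y` independent of the chosen `t z`.
  have key (g g' : G) (hg : g • x = g' • x) : g • y = g' • y := by
    rw [← inv_smul_eq_iff, smul_smul]
    rw [← inv_smul_eq_iff, smul_smul] at hg
    exact h _ hg
  refine ⟨⟨fun z => t z • y, fun g z => ?_⟩, ?_⟩
  · have := key (t (g • z)) (g * t z) (by rw [ht, mul_smul, ht])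
    rw [this, mul_smul]
    rfl
  · exact (key (t x) 1 (by rw [ht, one_smul])).trans (one_smul G y)

/-- Equivariant functions on a transitive `G`-set that agree at a point are equal. -/
theorem MulAction.IsPretransitive.hom_ext {G X Y : Type*} [Group G] [MulAction G X]
    [MulAction G Y] [MulAction.IsPretransitive G X] {f g : X →[G] Y} (x : X) (h : f x = g x) :
    f = g := by
  ext z
  obtain ⟨t, rfl⟩ := MulAction.exists_smul_eq G x z
  rw [map_smul, map_smul, h]

namespace NominalRep

/-- Transitive `G`-sets with points of the same stabilizer are isomorphic. -/
theorem GSet.nonempty_iso {G : Type w} [Group G] {X Y : GSet.{w} G}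
    [MulAction.IsPretransitive G X.carrier] [MulAction.IsPretransitive G Y.carrier]
    (x : X.carrier) (y : Y.carrier) (h : ∀ g : G, g • x = x ↔ g • y = y) : Nonempty (X ≅ Y) := by
  obtain ⟨f, hf⟩ := MulAction.IsPretransitive.exists_hom x y fun g => (h g).1
  obtain ⟨f', hf'⟩ := MulAction.IsPretransitive.exists_hom y x fun g => (h g).2
  refine ⟨⟨f, f', ?_, ?_⟩⟩
  · refine MulAction.IsPretransitive.hom_ext x ?_
    change f' (f x) = x
    rw [hf, hf']
  · refine MulAction.IsPretransitive.hom_ext y ?_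
    change f (f' y) = y
    rw [hf', hf]

/-- The least support of an element is preserved by the stabilizer of the element. -/
theorem mem_of_isLeast_supports {D X : Type w} {G : Subgroup (Equiv.Perm D)} [MulAction G X]
    {x : X} {C : Finset D} (hC : IsLeast {C : Finset D | MulAction.Supports G (C : Set D) x} C)
    {g : G} (hg : g • x = x) {a : D} (ha : a ∈ C) : g.1 a ∈ C := by
  -- By conjugation, `g⁻¹C` supports `g⁻¹ • x = x`; leastness then gives `C ⊆ g⁻¹C`.
  have h : C.map g.1.symm.toEmbedding ∈ {C : Finset D | MulAction.Supports G (C : Set D) x} := by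
    intro k hk
    have h' : (g * k * g⁻¹) • x = x := by
      refine hC.1 _ fun c hc => ?_
      have := hk (a := g⁻¹ • c) (Finset.mem_coe.2 (Finset.mem_map_of_mem _ hc))
      rw [mul_smul, mul_smul, this, smul_inv_smul]
    rw [mul_smul, mul_smul, smul_eq_iff_eq_inv_smul, inv_smul_eq_iff.2 hg.symm] at h'
    exact h'
  obtain ⟨c, hc, rfl⟩ := Finset.mem_map.1 (hC.2 h ha)
  simpa using hc

namespace StructRep

variable {L : FirstOrder.Language.{u, v}} {K : Set (Bundled.{w} L.Structure)} {U : Type w}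
  [L.Structure U]

theorem mem_age (hK : L.age U = K) (X : StructRep K) : X.shape ∈ L.age U :=
  hK.symm ▸ X.mem

/-- The class of an embedding. -/
def Sem.mk {X : StructRep K} (f : X.shape ↪[L] U) : Sem U X :=
  Quotient.mk (embSetoid (M := U) X.sym) f

theorem Sem.mk_eq_mk {X : StructRep K} {f g : X.shape ↪[L] U} :
    Sem.mk f = Sem.mk g ↔ ∃ τ ∈ X.sym, ∀ a, f (τ.1 a) = g a :=
  Quotient.eq (r := embSetoid (M := U) X.sym)

theorem Sem.smul_mk {X : StructRep K} (π : autGroup L U) (f : X.shape ↪[L] U) :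
    π • Sem.mk f = Sem.mk ((autEmb U π).comp f) :=
  rfl

theorem Sem.smul_mk_eq_mk {X : StructRep K} {π : autGroup L U} {f g : X.shape ↪[L] U} :
    π • Sem.mk f = Sem.mk g ↔ ∃ τ ∈ X.sym, ∀ a, π.1 (f (τ.1 a)) = g a := by
  simp [Sem.smul_mk, Sem.mk_eq_mk, autEmb_apply]

/-- An automorphism that agrees with `g ∘ f⁻¹` on the range of `f` sends `[f]` to `[g]`. -/
theorem Sem.smul_mk_eq_mk_of_forall {X : StructRep K} {π : autGroup L U} {f g : X.shape ↪[L] U}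
    (h : ∀ a, π.1 (f a) = g a) : π • Sem.mk f = Sem.mk g :=
  Sem.smul_mk_eq_mk.2 ⟨1, X.sym.one_mem, h⟩

theorem Sem.isPretransitive (hU : L.IsUltrahomogeneous U) (hK : L.age U = K) (X : StructRep K) :
    MulAction.IsPretransitive (autGroup L U) (Sem U X) where
  exists_smul_eq := by
    rintro ⟨f⟩ ⟨g⟩
    have hX := X.mem_age hK
    obtain ⟨π, hπ⟩ := hU.exists_autGroup hX.1 f g
    exact ⟨π, Sem.smul_mk_eq_mk_of_forall hπ⟩

theorem nonempty_embedding (hK : L.age U = K) (X : StructRep K) :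
    Nonempty (X.shape ↪[L] U) := by
  exact (X.mem_age hK).2

theorem Sem.supports_range {X : StructRep K} (f : X.shape ↪[L] U) :
    MulAction.Supports (autGroup L U) (Set.range f) (Sem.mk f) :=
  fun _ hπ => Sem.smul_mk_eq_mk_of_forall fun a => hπ ⟨a, rfl⟩

theorem finite_shape [L.IsRelational] (hK : L.age U = K) (X : StructRep K) :
    Finite X.shape := by
  exact (X.mem_age hK).1.finite

theorem isSingleOrbitNominal_sem [L.IsRelational] (hU : L.IsUltrahomogeneous U)
    (hK : L.age U = K) (X : StructRep K) :
    IsSingleOrbitNominal (autGroup L U) ((sem U).obj X) := by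
  refine ⟨(nonempty_embedding hK X).map Sem.mk, Sem.isPretransitive hU hK X, ?_⟩
  rintro ⟨f⟩
  have := finite_shape hK X
  refine ⟨(Set.finite_range f).toFinset, ?_⟩
  rw [Set.Finite.coe_toFinset]
  exact Sem.supports_range f

/-- In a fungible symmetry, every finite support of `[f]` contains the range of `f`. -/
theorem Sem.mem_of_supports [L.IsRelational] (hK : L.age U = K)
    (hfun : FungibleSymmetry (autGroup L U)) {X : StructRep K} {f : X.shape ↪[L] U} {C : Set U}
    (hfin : C.Finite) (hC : MulAction.Supports (autGroup L U) C (Sem.mk f)) (b : X.shape) :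
    f b ∈ C := by
  classical
  by_contra hb
  have := finite_shape hK X
  -- Here `π` moves `f b` but fixes `C` and the rest of the range of `f`. So it fixes `[f]` and must
  -- permute the range, yet no point of the range can be sent to `f b`.
  obtain ⟨π, hπ, hne, hfix⟩ := hfun (hfin.toFinset ∪ (Set.finite_range f).toFinset) (f b)
    (by simp)
  have hstab : (⟨π, hπ⟩ : autGroup L U) • Sem.mk f = Sem.mk f := by
    refine hC _ fun c hc => hfix c (by simp [hc]) ?_
    rintro rfl
    exact hb hc
  obtain ⟨τ, -, hτ⟩ := Sem.smul_mk_eq_mk.1 hstab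
  obtain ⟨d, hd⟩ : ∃ d, π (f d) = f b := ⟨_, hτ b⟩
  by_cases h : f d = f b
  · exact hne (h ▸ hd)
  · exact h ((hfix (f d) (by simp) h).symm.trans hd)

/-! ### Full faithfulness -/

/-- An embedding whose range is contained in that of `v` factors through `v`. -/
theorem exists_comp_eq {A B : Type w} [L.Structure A] [L.Structure B]
    (v : A ↪[L] U) (w : B ↪[L] U) (h : ∀ b, w b ∈ Set.range v) :
    ∃ u : B ↪[L] A, v.comp u = w := by
  let w' : B ↪[L] v.toHom.range := FirstOrder.Language.Embedding.codRestrict _ w h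
  refine ⟨v.equivRange.symm.toEmbedding.comp w', ?_⟩
  ext b
  have hv (z : v.toHom.range) : v (v.equivRange.symm z) = z := by
    conv_rhs => rw [← v.equivRange.apply_symm_apply z]
    rfl
  exact hv (w' b)

theorem map_injective (hK : L.age U = K) (X Y : StructRep K) :
    Function.Injective (fun f : X ⟶ Y => (sem U).map f) := by
  obtain ⟨v⟩ := nonempty_embedding hK X
  rintro ⟨f⟩ ⟨g⟩ h
  have h' : Sem.mk (v.comp f.1) = Sem.mk (v.comp g.1) :=
    DFunLike.congr_fun (F := Sem U X →[autGroup L U] Sem U Y) h (Sem.mk v)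
  obtain ⟨τ, hτ, h''⟩ := Sem.mk_eq_mk.1 h'
  exact Quotient.sound (s := homSetoid X Y) ⟨τ, hτ, fun a => v.injective (h'' a)⟩

theorem map_surjective [L.IsRelational] (hU : L.IsUltrahomogeneous U) (hK : L.age U = K)
    (hfun : FungibleSymmetry (autGroup L U)) (X Y : StructRep K) :
    Function.Surjective (fun f : X ⟶ Y => (sem U).map f) := by
  intro (F : Sem U X →[autGroup L U] Sem U Y)
  obtain ⟨v⟩ := nonempty_embedding hK X
  have := finite_shape hK X
  have := Sem.isPretransitive hU hK X
  obtain ⟨w, hw⟩ : ∃ w : Y.shape ↪[L] U, Sem.mk w = F (Sem.mk v) := Quotient.exists_rep _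
  have hsupp : MulAction.Supports (autGroup L U) (Set.range v) (Sem.mk w) := by
    intro π hπ
    rw [hw, ← map_smul, Sem.supports_range v π hπ]
  obtain ⟨f, rfl⟩ := exists_comp_eq v w (Sem.mem_of_supports hK hfun (Set.finite_range v) hsupp)
  have hf (σ) (hσ : σ ∈ X.sym) : ∃ τ ∈ Y.sym, ∀ b, σ.1 (f b) = f (τ.1 b) := by
    have hX := X.mem_age hK
    -- Extend `σ`, transported along `v`, to an automorphism `π` of `U`. It fixes `[v]`, hence also
    -- the image `[v ∘ f]`, and the witness of the latter is the required `τ`.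
    obtain ⟨π, hπ⟩ := hU.exists_autGroup hX.1 v (v.comp (autEmb _ σ))
    have hv : π • Sem.mk v = Sem.mk v := by
      refine Sem.smul_mk_eq_mk.2 ⟨σ⁻¹, X.sym.inv_mem hσ, fun a => ?_⟩
      rw [hπ]
      simp [autEmb_apply]
    have hvf : π⁻¹ • Sem.mk (v.comp f) = Sem.mk (v.comp f) := by
      rw [hw, ← map_smul, inv_smul_eq_iff.2 hv.symm]
    obtain ⟨τ, hτ, h⟩ := Sem.smul_mk_eq_mk.1 hvf
    refine ⟨τ, hτ, fun b => v.injective ?_⟩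
    have h₁ : v (f (τ.1 b)) = π.1 (v (f b)) := by
      rw [← show _ = v (f b) from h b]
      simp
    rw [h₁, hπ]
    simp [autEmb_apply]
  exact ⟨Quotient.mk (homSetoid X Y) ⟨f, hf⟩,
    MulAction.IsPretransitive.hom_ext (X := Sem U X) (Y := Sem U Y) (Sem.mk v) hw⟩

/-! ### Representing single-orbit nominal sets -/

/-- The automorphisms of a substructure `A` that extend to an automorphism of `U` fixing `x`. -/
def restrictedStabilizer {X : Type w} [MulAction (autGroup L U) X] (x : X)
    (A : L.Substructure U) : Subgroup (autGroup L A) where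
  carrier := {τ | ∃ ρ : autGroup L U, ρ • x = x ∧ ∀ a : A, ρ.1 a = τ.1 a}
  mul_mem' := by
    rintro σ τ ⟨ρ, hρ, h⟩ ⟨ρ', hρ', h'⟩
    refine ⟨ρ * ρ', by rw [mul_smul, hρ', hρ], fun a => ?_⟩
    change ρ.1 (ρ'.1 a) = σ.1 (τ.1 a)
    rw [h', h]
  one_mem' := ⟨1, one_smul _ x, fun _ => rfl⟩
  inv_mem' := by
    rintro τ ⟨ρ, hρ, h⟩
    refine ⟨ρ⁻¹, (inv_smul_eq_iff.2 hρ.symm), fun a => ?_⟩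
    change ρ.1⁻¹ (a : U) = (τ.1⁻¹ a : A)
    rw [Equiv.Perm.inv_eq_iff_eq, h]
    exact congrArg Subtype.val (τ.1.apply_symm_apply a).symm

/-- The restriction of an automorphism of `U` to a substructure that it preserves. -/
theorem exists_autGroup_restrict [L.IsRelational] {A : L.Substructure U} {π : autGroup L U}
    (h : ∀ a ∈ A, π.1 a ∈ A) (h' : ∀ a ∈ A, π⁻¹.1 a ∈ A) :
    ∃ τ : autGroup L A, ∀ a : A, π.1 a = τ.1 a := by
  let e : A ≃[L] A :=
    { toFun := fun a => ⟨π.1 a, h a a.2⟩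
      invFun := fun a => ⟨π⁻¹.1 a, h' a a.2⟩
      left_inv := fun a => by simp
      right_inv := fun a => by simp
      map_fun' := fun f => isEmptyElim f
      map_rel' := fun {n} r x => by
        have := (autEmb U π).map_rel r (fun i => (x i : U))
        simp only [Function.comp_def, autEmb_apply] at this
        exact this }
  exact ⟨⟨e.toEquiv, e, rfl⟩, fun a => rfl⟩

/-- The inclusion of the least support of `x` has a class with the same stabilizer as `x`. -/
theorem exists_iso_sem [L.IsRelational] (hU : L.IsUltrahomogeneous U) (hK : L.age U = K)
    (hls : AdmitsLeastSupports (autGroup L U)) {N : GSet (autGroup L U)}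
    (hN : IsSingleOrbitNominal (autGroup L U) N) :
    ∃ X : StructRep K, Nonempty (N ≅ (sem U).obj X) := by
  obtain ⟨⟨x⟩, htrans, hnom⟩ := hN
  obtain ⟨C, hC⟩ := hls N.carrier hnom x
  -- In a relational language the closure adds no points.
  let A : L.Substructure U := FirstOrder.Language.Substructure.closure L (C : Set U)
  have hA (a : U) : a ∈ A ↔ a ∈ C := by
    simp [A, FirstOrder.Language.Substructure.mem_closure_iff_of_isRelational]
  have hFG : A.FG := FirstOrder.Language.Substructure.fg_closure C.finite_toSet
  let X : StructRep K :=
    { shape := Bundled.of A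
      mem := by
        rw [← hK]
        exact ⟨(FirstOrder.Language.Substructure.fg_iff_structure_fg A).1 hFG, ⟨A.subtype⟩⟩
      sym := restrictedStabilizer x A }
  have : MulAction.IsPretransitive (autGroup L U) ((sem U).obj X).carrier :=
    Sem.isPretransitive hU hK X
  refine ⟨X, GSet.nonempty_iso x (Sem.mk (X := X) A.subtype) fun π => ⟨fun hπ => ?_, fun hπ => ?_⟩⟩
  · have hπ' : π⁻¹ • x = x := inv_smul_eq_iff.2 hπ.symm
    obtain ⟨τ, hτ⟩ := exists_autGroup_restrict (A := A) (π := π)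
      (fun a ha => (hA _).2 (mem_of_isLeast_supports hC hπ ((hA a).1 ha)))
      (fun a ha => (hA _).2 (mem_of_isLeast_supports hC hπ' ((hA a).1 ha)))
    refine Sem.smul_mk_eq_mk.2 ⟨τ⁻¹, X.sym.inv_mem (show τ ∈ restrictedStabilizer x A from ⟨π, hπ, hτ⟩), fun a => ?_⟩
    refine (hτ _).trans (congrArg Subtype.val ?_)
    exact τ.1.apply_symm_apply a
  · obtain ⟨τ, hmem, hτ⟩ := Sem.smul_mk_eq_mk.1 hπ
    obtain ⟨ρ, hρ, h⟩ : τ ∈ restrictedStabilizer x A := hmem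
    -- On `C`, `ρ` agrees with `τ` and `π` undoes `τ`, so `π * ρ` fixes `C` pointwise.
    have h' : (π * ρ) • x = x := by
      refine hC.1 _ fun a ha => ?_
      have ha' := (hA a).2 ha
      refine (congrArg π.1 (h ⟨a, ha'⟩)).trans (hτ ⟨a, ha'⟩)
    rwa [mul_smul, hρ] at h'

end StructRep

end NominalRep

theorem theorem10p6 {L : FirstOrder.Language.{u, v}} [L.IsRelational] [Finite (Σ n, L.Relations n)]
    (K : Set (Bundled.{w} L.Structure)) (U : Type w) [L.Structure U] [Countable U]
    (hU : FirstOrder.Language.IsFraisseLimit K U) (hwb : NominalRep.WellBehaved (NominalRep.autGroup L U)) :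
    (∀ X : NominalRep.StructRep K,
      NominalRep.IsSingleOrbitNominal (NominalRep.autGroup L U)
        ((NominalRep.StructRep.sem U).obj X)) ∧
    (∀ N : NominalRep.SingleOrbitNom (NominalRep.autGroup L U),
      ∃ X : NominalRep.StructRep K, Nonempty (N.obj ≅ (NominalRep.StructRep.sem U).obj X)) ∧
    (∀ X Y : NominalRep.StructRep K, Function.Bijective
      (fun f : X ⟶ Y => (NominalRep.StructRep.sem U).map f)) ∧
    (∃ e : NominalRep.SingleOrbitNom (NominalRep.autGroup L U) ≌ NominalRep.StructRep K,
      Nonempty (e.inverse ⋙ (NominalRep.IsSingleOrbitNominal (NominalRep.autGroup L U)).ι ≅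
        NominalRep.StructRep.sem U)) := by
  have hH := hU.ultrahomogeneous
  have hK := hU.age
  have h₁ := NominalRep.StructRep.isSingleOrbitNominal_sem hH hK
  have h₃ (X Y : NominalRep.StructRep K) : Function.Bijective
      (fun f : X ⟶ Y => (NominalRep.StructRep.sem U).map f) :=
    ⟨NominalRep.StructRep.map_injective hK X Y,
      NominalRep.StructRep.map_surjective hH hK hwb.fungible X Y⟩
  have h₂ (N : NominalRep.SingleOrbitNom (NominalRep.autGroup L U)) :=
    NominalRep.StructRep.exists_iso_sem hH hK hwb.admitsLeastSupports N.property
  refine ⟨h₁, h₂, h₃, ?_⟩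
  let P := NominalRep.IsSingleOrbitNominal (NominalRep.autGroup L U)
  let F := P.lift (NominalRep.StructRep.sem (K := K) U) h₁
  have hF : (NominalRep.StructRep.sem (K := K) U).FullyFaithful :=
    ⟨fun {X Y} => (Equiv.ofBijective _ (h₃ X Y)).symm,
      fun {X Y} => (Equiv.ofBijective _ (h₃ X Y)).apply_symm_apply,
      fun {X Y} => (Equiv.ofBijective _ (h₃ X Y)).symm_apply_apply⟩
  have := hF.full
  have := hF.faithful
  have : F.EssSurj := ⟨fun N => by
    obtain ⟨X, ⟨i⟩⟩ := h₂ N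
    exact ⟨X, ⟨P.isoMk i.symm⟩⟩⟩
  have : F.IsEquivalence := {}
  exact ⟨F.asEquivalence.symm, ⟨P.liftCompιIso _ h₁⟩⟩
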